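/- Let $q$ be a power of an odd prime, let $n$ be a positive integer and let $a\in\mathbb F_q^{*}$. Let $\chi_q$ be the quadratic character of $\mathbb F_q$. **Rédei function.** Write the binomial expansion $(x+\sqrt y)^n=N(x,y)+D(x,y)\sqrt y$. The Rédei function $R_n=R_n(x,a)=N(x,a)/D(x,a)$ is a map on $\mathbb P^1(\mathbb F_q)=\mathbb F_q\cup\{\infty\}$ (with $R_n(\infty)=\infty$, and $R_n(x)=\infty$ if $D(x,a)=0$). Let $\mathbb D_q=\mathbb P^1(\mathbb F_q)\setminus\{\pm\sqrt a\}$, i.e. the square roots of $a$ that lie in $\mathbb F_q$ are removed. **Graphs.** For a map $f$, $\mathcal G(f/X)$ denotes the directed graph with vertex set $X$ and edges $x\to f(x)$, $x\in X$. $\bigoplus$ denotes disjoint union of directed graphs and $k\times G$ the disjoint union of $k$ copies of $G$. Edges of rooted trees point towards the root; $\bullet$ is the tree with one node, and for a forest $G$ (a disjoint union of rooted trees) $\langle G\rangle$ is the rooted tree whose root has as predecessors exactly the roots of the trees of $G$. $\mathrm{Cyc}(m,T)$ is a directed cycle of length $m$, each node of which is the root of a copy of the tree $T$. **Trees.** For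 a non-increasing sequence $V=(v_1,\dots,v_d)$ of positive integers, $d\ge 1$, put $T_V^0=\bullet$, and $$T_V^k=\Big\langle v_k\times T_V^{k-1}\oplus\bigoplus_{i=1}^{k-1}(v_i-v_{i+1})\times T_V^{i-1}\Big\rangle\ (1\le k<d),\qquad T_V=\Big\langle (v_d-1)\times T_V^{d-1}\oplus\bigoplus_{i=1}^{d-1}(v_i-v_{i+1})\times T_V^{i-1}\Big\rangle .$$ For positive integers $\nu,n$ such that every prime divisor of $\nu$ divides $n$, the $\nu$-series $\nu(n)=(a_1,\dots,a_d)$ is given by $a_1=\gcd(\nu,n)$, $a_{i+1}=\gcd\big(\nu/(a_1\cdots a_i),n\big)$, where $d$ is the least positive integer with $a_1\cdots a_d=\nu$. **Theorem.** Write $q-\chi_q(a)=\nu\omega$ with positive integers $\nu,\omega$ such that $\mathrm{rad}(\nu)\mid\mathrm{rad}(n)$ and $\gcd(n,\omega)=1$. Then $R_n$ maps $\mathbb D_q$ to itself, and there is an isomorphism of directed graphs $$\mathcal G(R_n/\mathbb D_q)\;\cong\;\bigoplus_{d\mid\omega}\frac{\varphi(d)}{\mathrm{ord}_d(n)}\times\mathrm{Cyc}\big(\mathrm{ord}_d(n),T_{\nu(n)}\big),$$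 where $d$ runs over the positive divisors of $\omega$, $\varphi$ is Euler's function and $\mathrm{ord}_d(n)$ is the multiplicative order of $n$ modulo $d$. -/

import Mathlib

/-! ### Directed graphs -/

/-- The functional graph `G(f/S)`: its vertices are the elements of `S`, and there is an edge
from `u` to `v` exactly when `f u = v`. -/
def functionalGraph {X : Type*} (f : X → X) (S : Set X) : Digraph S where
  Adj u v := f u = v

/-- The disjoint union `⨁ i, G i` of a family of directed graphs. -/
def disjointUnion {ι : Type*} {V : ι → Type*} (G : ∀ i, Digraph (V i)) :
    Digraph (Σ i, V i) where
  Adj p q := ∃ (i : ι) (u v : V i), p = ⟨i, u⟩ ∧ q = ⟨i, v⟩ ∧ (G i).Adj u v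

/-- `k × G`, the disjoint union of `k` copies of `G`. -/
def copies {V : Type*} (k : ℕ) (G : Digraph V) : Digraph (Σ _ : Fin k, V) :=
  disjointUnion fun _ : Fin k => G

/-- Isomorphism of directed graphs: a bijection of the vertices that preserves and reflects
the edges. -/
def IsomorphicDigraphs {V W : Type*} (G : Digraph V) (H : Digraph W) : Prop :=
  Nonempty (G.Adj ≃r H.Adj)

/-! ### Rooted trees -/

/-- A rooted tree: every vertex has a parent, the root being (by convention) its own parent, and
every vertex reaches the root when one passes repeatedly to the parent. -/
structure ParentTree where
  /-- the vertices -/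
  V : Type
  /-- the root -/
  root : V
  /-- the parent of a vertex -/
  parent : V → V
  parent_root : parent root = root
  reaches_root : ∀ v, ∃ k : ℕ, parent^[k] v = root

namespace ParentTree

/-- The tree as a directed graph: each vertex other than the root has one edge, to its parent
(so that edges point towards the root). -/
def toDigraph (T : ParentTree) : Digraph T.V where
  Adj u v := u ≠ T.root ∧ T.parent u = v

/-- The tree `•` with a unique vertex. -/
def bullet : ParentTree where
  V := Unit
  root := ()
  parent := id
  parent_root := rfl
  reaches_root := fun _ => ⟨0, rfl⟩

open Classical in
/-- The parent map of `⟨F⟩`: `none` is the new root, and the roots of the trees in the forest `F`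
are its predecessors. -/
noncomputable def graftParent {ι : Type} (F : ι → ParentTree) :
    Option (Σ i, (F i).V) → Option (Σ i, (F i).V)
  | none => none
  | some ⟨i, v⟩ => if v = (F i).root then none else some ⟨i, (F i).parent v⟩

theorem graft_reaches {ι : Type} (F : ι → ParentTree) (x : Option (Σ i, (F i).V)) :
    ∃ k : ℕ, (graftParent F)^[k] x = none := by
  rcases x with _ | ⟨i, v⟩
  · exact ⟨0, rfl⟩
  · obtain ⟨k, hk⟩ := (F i).reaches_root v
    induction k generalizing v with
    | zero =>
      refine ⟨1, ?_⟩
      have hv : v = (F i).root := hk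
      simp [graftParent, hv]
    | succ k ih =>
      by_cases hv : v = (F i).root
      · exact ⟨1, by simp [graftParent, hv]⟩
      · obtain ⟨l, hl⟩ := ih ((F i).parent v) hk
        refine ⟨l + 1, ?_⟩
        rw [Function.iterate_succ_apply]
        simpa [graftParent, hv] using hl

/-- `⟨F⟩`, for a forest `F` given as a family of rooted trees: the rooted tree whose root has as
predecessors exactly the roots of the trees of `F`. -/
noncomputable def graft {ι : Type} (F : ι → ParentTree) : ParentTree where
  V := Option (Σ i, (F i).V)
  root := none
  parent := graftParent F
  parent_root := rfl
  reaches_root := graft_reaches F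

/-- `Cyc(m, T)` for `m ≥ 1`: a directed cycle of length `m`, each of whose vertices is the root of
a copy of the tree `T`. The vertex `(i, v)` is the vertex `v` of the `i`-th copy. -/
def cyc (m : ℕ) (T : ParentTree) : Digraph (ZMod m × T.V) where
  Adj p q := (p.1 = q.1 ∧ T.toDigraph.Adj p.2 q.2) ∨
    (p.2 = T.root ∧ q.2 = T.root ∧ q.1 = p.1 + 1)

end ParentTree

/-! ### Elementary trees

A finite sequence `(v₁, …, v_d)` is given by its length `d` and the function `v : ℕ → ℕ` with
`v i = v_{i+1}` for `i < d`. -/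

/-- The trees `T_v^k`: `T_v^0 = •` and
`T_v^k = ⟨v_k × T_v^{k-1} ⊕ ⨁_{i=1}^{k-1} (v_i - v_{i+1}) × T_v^{i-1}⟩`. -/
noncomputable def partialTree (v : ℕ → ℕ) : ℕ → ParentTree
  | 0 => ParentTree.bullet
  | k + 1 => ParentTree.graft
      (ι := Fin (v k) ⊕ (Σ i : Fin k, Fin (v i - v (i + 1))))
      (Sum.elim (fun _ => partialTree v k) (fun p => partialTree v p.1))
termination_by k => k
decreasing_by
  · exact Nat.lt_succ_self k
  · exact Nat.lt_succ_of_lt p.1.isLt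

/-- The elementary tree `T_v` of the non-increasing sequence of positive integers
`v = (v₁, …, v_d)`, `d ≥ 1`:
`T_v = ⟨(v_d - 1) × T_v^{d-1} ⊕ ⨁_{i=1}^{d-1} (v_i - v_{i+1}) × T_v^{i-1}⟩`. -/
noncomputable def elementaryTree (v : ℕ → ℕ) : ℕ → ParentTree
  | 0 => ParentTree.bullet
  | d + 1 => ParentTree.graft
      (ι := Fin (v d - 1) ⊕ (Σ i : Fin d, Fin (v i - v (i + 1))))
      (Sum.elim (fun _ => partialTree v d) (fun p => partialTree v p.1))

/-! ### The `ν`-series `b(a) = (a₁, …, a_d)`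

Here `a₁ = gcd(b, a)`, `a_{i+1} = gcd(b / (a₁ ⋯ a_i), a)`, and `d` is the least positive integer
with `a₁ ⋯ a_d = b`. -/

/-- The product `a₁ ⋯ a_i` of the first `i` terms of the `ν`-series `b(a)`. -/
def nuProd (b a : ℕ) : ℕ → ℕ
  | 0 => 1
  | i + 1 => nuProd b a i * Nat.gcd (b / nuProd b a i) a

/-- The term `a_{i+1}` of the `ν`-series `b(a)`. -/
def nuTerm (b a i : ℕ) : ℕ := Nat.gcd (b / nuProd b a i) a

/-- The length `d` of the `ν`-series `b(a)`. -/
noncomputable def nuLength (b a : ℕ) : ℕ := sInf {d : ℕ | 0 < d ∧ nuProd b a d = b}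

/-- The tree `T_{b(a)}` associated with the `ν`-series `b(a)`. -/
noncomputable def nuTree (b a : ℕ) : ParentTree := elementaryTree (nuTerm b a) (nuLength b a)

/-! ### Rédei functions -/

section Redei

variable {F : Type*} [Field F]

/-- `N(x, y)`, where `(x + √y)^n = N(x, y) + D(x, y) √y` is the binomial expansion. -/
def redeiNum (n : ℕ) (x y : F) : F :=
  ∑ i ∈ Finset.range (n / 2 + 1), (n.choose (2 * i) : F) * x ^ (n - 2 * i) * y ^ i

/-- `D(x, y)`, where `(x + √y)^n = N(x, y) + D(x, y) √y` is the binomial expansion. -/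
def redeiDen (n : ℕ) (x y : F) : F :=
  ∑ i ∈ Finset.range ((n + 1) / 2),
    (n.choose (2 * i + 1) : F) * x ^ (n - (2 * i + 1)) * y ^ i

open Classical in
/-- The Rédei function `R_n(x, a) = N(x, a) / D(x, a)` on the projective line `F ∪ {∞}`, for
`n ≥ 1`. As polynomials in `x`, `N(x, a)` is monic of degree `n` and `D(x, a)` has smaller degree,
hence `∞ ↦ ∞`; they have no common zero if `a ≠ 0` and the characteristic of `F` is not `2`, hence
the zeros of `D(x, a)` are mapped to `∞`. -/
noncomputable def redei (n : ℕ) (a : F) : OnePoint F → OnePoint F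
  | none => OnePoint.infty
  | some x => if redeiDen n x a = 0 then OnePoint.infty
      else ((redeiNum n x a / redeiDen n x a : F) : OnePoint F)

/-- The set `ℙ¹(F) ∖ {±√a}`: the square roots of `a` in `F` are removed. These are two points if
`a` is a nonzero square (in odd characteristic), and none if `a` is not a square in `F`. -/
def redeiDomain (a : F) : Set (OnePoint F) :=
  {x | ∀ s : F, s ^ 2 = a → x ≠ (s : OnePoint F)}

end Redei

/-! Let s be a square root of `a` in an algebraic closure. The map x ↦ (x + s)/(x - s) turns R_n
into t ↦ t^n (`cayley_redei`). By Frobenius its values on `redeiDomain a` are N-th roots of unity, N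
= q - χ(a) (`cayley_pow_eq_one`), and a count shows that all of them occur. So R_n is conjugate to
multiplication by n on ℤ/N ≅ ℤ/ν × ℤ/ω.

On ℤ/ω this is a permutation preserving additive orders, and the elements of order d lie on cycles
of length ord_d(n) (`exists_equiv_cycles`). On ℤ/ν it is nilpotent, hence a tree with root 0. The
subtree at x ≠ 0 depends only on the largest j with x ∈ n^j ℤ/ν: the solutions of n z = x inside
each n^i ℤ/ν form the empty set or a coset of a kernel whose order is a term of the ν-series
(`ncard_preimagesIn`, `mulTree_isomorphic_nuTree`).

The product of the tree and the cycles is then sheared into cycles carrying trees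
(`exists_equiv_tree_prod_cycles`). -/

/-! ### Isomorphism, depth and subtrees of rooted trees -/

namespace ParentTree

/-- Isomorphism of rooted trees, as a proposition. -/
def Isomorphic (T T' : ParentTree) : Prop :=
  ∃ e : T.V ≃ T'.V, e T.root = T'.root ∧ ∀ v, e (T.parent v) = T'.parent (e v)

theorem Isomorphic.symm {T T' : ParentTree} (h : Isomorphic T T') : Isomorphic T' T := by
  obtain ⟨e, h₁, h₂⟩ := h
  refine ⟨e.symm, by rw [← h₁, e.symm_apply_apply], fun v => ?_⟩
  rw [e.symm_apply_eq, h₂, e.apply_symm_apply]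

theorem Isomorphic.trans {T T' T'' : ParentTree} (h : Isomorphic T T') (h' : Isomorphic T' T'') :
    Isomorphic T T'' := by
  obtain ⟨e, h₁, h₂⟩ := h
  obtain ⟨e', h₁', h₂'⟩ := h'
  exact ⟨e.trans e', by simp [h₁, h₁'], fun v => by simp [h₂, h₂']⟩

theorem graft_congr {ι κ : Type} {A : ι → ParentTree} {B : κ → ParentTree} (e : ι ≃ κ)
    (h : ∀ i, Isomorphic (A i) (B (e i))) : Isomorphic (graft A) (graft B) := by
  choose f hroot hparent using h
  refine ⟨Equiv.optionCongr (Equiv.sigmaCongr e f), rfl, ?_⟩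
  rintro (_ | ⟨i, v⟩)
  · rfl
  · change (Equiv.optionCongr (Equiv.sigmaCongr e f)) (graftParent A (some ⟨i, v⟩)) =
      graftParent B (some ⟨e i, f i v⟩)
    have hv : f i v = (B (e i)).root ↔ v = (A i).root := by
      rw [← hroot, (f i).apply_eq_iff_eq]
    by_cases h : v = (A i).root
    · simp [graftParent, h, hroot]
    · simp only [graftParent, h, hv, if_false, ← hparent]
      rfl

theorem graft_of_isEmpty {ι : Type} [IsEmpty ι] (A : ι → ParentTree) :
    Isomorphic (graft A) bullet := by
  refine ⟨⟨fun _ => (), fun _ => none, ?_, fun _ => rfl⟩, rfl, fun _ => rfl⟩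
  rintro (_ | ⟨i, v⟩)
  · rfl
  · exact (IsEmpty.false i).elim

variable (T : ParentTree)

open Classical in
/-- The number of edges on the path from a vertex to the root. -/
noncomputable def depth (v : T.V) : ℕ := Nat.find (T.reaches_root v)

variable {T}

theorem parent_iterate_root (k : ℕ) : T.parent^[k] T.root = T.root :=
  Function.iterate_fixed T.parent_root k

theorem parent_iterate_depth (v : T.V) : T.parent^[T.depth v] v = T.root := by
  classical exact Nat.find_spec (T.reaches_root v)

theorem depth_root : T.depth T.root = 0 := by
  classical exact (Nat.find_eq_zero _).2 rfl

theorem depth_le {v : T.V} {k : ℕ} (h : T.parent^[k] v = T.root) : T.depth v ≤ k := by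
  classical exact Nat.find_min' _ h

theorem depth_eq_of_ne {v : T.V} (hv : v ≠ T.root) :
    T.depth v = T.depth (T.parent v) + 1 := by
  apply le_antisymm
  · exact depth_le (by rw [Function.iterate_succ_apply, parent_iterate_depth])
  · have h := parent_iterate_depth v
    cases hd : T.depth v with
    | zero => rw [hd] at h; exact absurd h hv
    | succ k =>
      rw [hd, Function.iterate_succ_apply] at h
      exact Nat.succ_le_succ (depth_le h)

theorem depth_eq_of_iterate_ne {k : ℕ} {v : T.V} (h : T.parent^[k] v ≠ T.root) :
    T.depth v = T.depth (T.parent^[k] v) + k := by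
  induction k generalizing v with
  | zero => rfl
  | succ k ih =>
    have hv : v ≠ T.root := by
      rintro rfl
      exact h (parent_iterate_root _)
    rw [Function.iterate_succ_apply] at h ⊢
    rw [depth_eq_of_ne hv, ih h, add_assoc]

variable (T)

open Classical in
/-- The tree formed by the vertices from which `x` can be reached. -/
noncomputable def subtree (x : T.V) : ParentTree where
  V := {y : T.V // ∃ k, T.parent^[k] y = x}
  root := ⟨x, 0, rfl⟩
  parent y := if h : y.1 = x then ⟨x, 0, rfl⟩ else
    ⟨T.parent y.1, by
      obtain ⟨k, hk⟩ := y.2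
      cases k with
      | zero => exact absurd hk h
      | succ k => exact ⟨k, hk⟩⟩
  parent_root := by simp
  reaches_root := by
    rintro ⟨y, k, hk⟩
    induction k generalizing y with
    | zero => exact ⟨0, Subtype.ext hk⟩
    | succ k ih =>
      by_cases h : y = x
      · exact ⟨0, Subtype.ext h⟩
      · obtain ⟨l, hl⟩ := ih (T.parent y) hk
        refine ⟨l + 1, ?_⟩
        rw [Function.iterate_succ_apply]
        simpa [h] using hl

variable {T} in
theorem subtree_parent_val {x : T.V} (y : (T.subtree x).V) (h : y.1 ≠ x) :
    ((T.subtree x).parent y).1 = T.parent y.1 := by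
  simp [subtree, h]

theorem subtree_root : Isomorphic T (T.subtree T.root) := by
  refine ⟨⟨fun v => ⟨v, T.reaches_root v⟩, fun v => v.1, fun _ => rfl, fun _ => rfl⟩, rfl, ?_⟩
  intro v
  by_cases h : v = T.root
  · subst h
    exact (Subtype.ext T.parent_root).trans (T.subtree T.root).parent_root.symm
  · exact Subtype.ext (subtree_parent_val (x := T.root) ⟨v, T.reaches_root v⟩ h).symm

/-- The vertices whose edge leads to `x`. -/
def Child (x : T.V) : Type := {z : T.V // z ≠ T.root ∧ T.parent z = x}

variable {T}

theorem depth_of_child {x z : T.V} (hz : z ≠ T.root) (hzx : T.parent z = x) {y : T.V} {k : ℕ}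
    (hk : T.parent^[k] y = z) : T.depth y = T.depth x + 1 + k := by
  subst hk
  rw [depth_eq_of_iterate_ne hz, depth_eq_of_ne hz, hzx]

variable (T)

/-- A vertex other than `x` that reaches `x` does so through exactly one child; depth determines the
number of steps to that child, hence the child. As `Child` excludes the root, the loop at the root
does no harm when `x` is the root. -/
theorem subtree_isomorphic_graft (x : T.V) :
    Isomorphic (T.subtree x) (graft fun z : T.Child x => T.subtree z.1) := by
  apply Isomorphic.symm
  let φ : (graft fun z : T.Child x => T.subtree z.1).V → (T.subtree x).V := fun p =>
    match p with
    | none => ⟨x, 0, rfl⟩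
    | some ⟨z, y⟩ => ⟨y.1, by
        obtain ⟨k, hk⟩ := y.2
        exact ⟨k + 1, by rw [Function.iterate_succ_apply', hk, z.2.2]⟩⟩
  have hne : ∀ (z : T.Child x) (y : (T.subtree z.1).V), y.1 ≠ x := by
    rintro ⟨z, hz, hzx⟩ ⟨y, k, hk⟩ h
    have := depth_of_child hz hzx hk
    dsimp only at h
    rw [h] at this
    omega
  have hφ : Function.Bijective φ := by
    constructor
    · rintro (_ | ⟨z, y⟩) (_ | ⟨z', y'⟩) h
      · rfl
      · exact absurd (congrArg Subtype.val h).symm (hne z' y')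
      · exact absurd (congrArg Subtype.val h) (hne z y)
      · obtain ⟨y, k, hk⟩ := y
        obtain ⟨y', k', hk'⟩ := y'
        obtain rfl : y = y' := congrArg Subtype.val h
        have h₁ := depth_of_child z.2.1 z.2.2 hk
        have h₂ := depth_of_child z'.2.1 z'.2.2 hk'
        obtain rfl : k = k' := by omega
        obtain rfl : z = z' := Subtype.ext (hk.symm.trans hk')
        rfl
    · rintro ⟨y, k, hk⟩
      induction k with
      | zero => exact ⟨none, Subtype.ext hk.symm⟩
      | succ k ih =>
        by_cases hr : T.parent^[k] y = T.root
        · apply ih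
          rw [Function.iterate_succ_apply', hr, T.parent_root] at hk
          rw [hr, hk]
        · exact ⟨some ⟨⟨T.parent^[k] y, hr, by rw [← hk, Function.iterate_succ_apply']⟩,
            ⟨y, k, rfl⟩⟩, rfl⟩
  refine ⟨Equiv.ofBijective φ hφ, rfl, ?_⟩
  rintro (_ | ⟨z, y⟩)
  · exact ((T.subtree x).parent_root).symm
  · change φ (graftParent _ (some ⟨z, y⟩)) = (T.subtree x).parent (φ (some ⟨z, y⟩))
    have h₁ := subtree_parent_val (φ (some ⟨z, y⟩)) (hne z y)
    by_cases h : y = (T.subtree z.1).root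
    · subst h
      simp only [graftParent, if_true]
      exact Subtype.ext (h₁.trans z.2.2).symm
    · simp only [graftParent, h, if_false]
      have hy : y.1 ≠ z.1 := fun h' => h (Subtype.ext h')
      exact Subtype.ext ((subtree_parent_val y hy).trans h₁.symm)

end ParentTree

/-! ### The ν-series and the chain of subgroups n^j ℤ/ν -/

theorem nuProd_eq_gcd (ν n j : ℕ) : nuProd ν n j = Nat.gcd ν (n ^ j) := by
  induction j with
  | zero => simp [nuProd]
  | succ j ih =>
    rw [nuProd, ih, ← Nat.gcd_mul_left, Nat.mul_div_cancel' (Nat.gcd_dvd_left _ _),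
      ← Nat.gcd_mul_right, ← Nat.gcd_assoc,
      Nat.gcd_eq_left (Nat.dvd_mul_right ν n), pow_succ]

/-- The subgroup of the multiples of `n ^ j` in `ℤ/ν`. -/
def powMultiples (ν n j : ℕ) : AddSubgroup (ZMod ν) :=
  (nsmulAddMonoidHom (n ^ j) : ZMod ν →+ ZMod ν).range

section powMultiples

variable {ν n : ℕ}

theorem mem_powMultiples {j : ℕ} {x : ZMod ν} :
    x ∈ powMultiples ν n j ↔ ∃ y, (n : ZMod ν) ^ j * y = x := by
  simp [powMultiples, AddMonoidHom.mem_range]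

theorem mem_powMultiples_zero (x : ZMod ν) : x ∈ powMultiples ν n 0 :=
  mem_powMultiples.2 ⟨x, by simp⟩

theorem powMultiples_antitone : Antitone (powMultiples ν n) := by
  apply antitone_nat_of_succ_le
  intro j x hx
  obtain ⟨y, rfl⟩ := mem_powMultiples.1 hx
  exact mem_powMultiples.2 ⟨n * y, by ring⟩

theorem mul_mem_powMultiples_succ {j : ℕ} {z : ZMod ν} (hz : z ∈ powMultiples ν n j) :
    (n : ZMod ν) * z ∈ powMultiples ν n (j + 1) := by
  obtain ⟨y, rfl⟩ := mem_powMultiples.1 hz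
  exact mem_powMultiples.2 ⟨y, by ring⟩

theorem eq_zero_of_mem_powMultiples {j : ℕ} (hj : ν ∣ n ^ j) {x : ZMod ν}
    (hx : x ∈ powMultiples ν n j) : x = 0 := by
  obtain ⟨y, rfl⟩ := mem_powMultiples.1 hx
  rw [← Nat.cast_pow, (ZMod.natCast_eq_zero_iff _ _).2 hj, zero_mul]

theorem natCard_powMultiples [NeZero ν] (j : ℕ) :
    Nat.card (powMultiples ν n j) = ν / nuProd ν n j := by
  rw [powMultiples, IsAddCyclic.card_nsmulAddMonoidHom_range, Nat.card_zmod, nuProd_eq_gcd]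

/-- The solutions of `n z = x` among the multiples of `n ^ j`. -/
def preimagesIn (n : ℕ) (x : ZMod ν) (j : ℕ) : Set (ZMod ν) :=
  {z | z ∈ powMultiples ν n j ∧ (n : ZMod ν) * z = x}

/-- This set is the kernel of multiplication by n on a cyclic group of order ν / gcd(ν, n^j), so its
size is the gcd of that order with n. -/
theorem ncard_preimagesIn_zero [NeZero ν] (j : ℕ) :
    (preimagesIn n (0 : ZMod ν) j).ncard = nuTerm ν n j := by
  rw [nuTerm, ← natCard_powMultiples, ← IsAddCyclic.card_nsmulAddMonoidHom_ker,
    ← Nat.card_coe_set_eq]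
  refine Nat.card_congr ⟨fun z => ⟨⟨z.1, z.2.1⟩, ?_⟩, fun z => ⟨z.1.1, z.1.2, ?_⟩,
    fun _ => rfl, fun _ => rfl⟩
  · apply Subtype.ext
    simpa using z.2.2
  · have := congrArg Subtype.val ((AddMonoidHom.mem_ker).1 z.2)
    simpa using this

/-- If x = n^(j+1) y, then n^j y is one solution and the others differ from it by elements of the
kernel. -/
theorem ncard_preimagesIn [NeZero ν] {j : ℕ} {x : ZMod ν}
    (hx : x ∈ powMultiples ν n (j + 1)) : (preimagesIn n x j).ncard = nuTerm ν n j := by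
  obtain ⟨y, rfl⟩ := mem_powMultiples.1 hx
  have hy : (n : ZMod ν) ^ j * y ∈ powMultiples ν n j := mem_powMultiples.2 ⟨y, rfl⟩
  rw [← ncard_preimagesIn_zero, ← Set.ncard_image_of_injective (preimagesIn n (0 : ZMod ν) j)
    (add_right_injective ((n : ZMod ν) ^ j * y))]
  congr 1
  ext z
  constructor
  · rintro ⟨h₁, h₂⟩
    refine ⟨z - n ^ j * y, ⟨sub_mem h₁ hy, ?_⟩, by ring⟩
    rw [mul_sub, h₂]
    ring
  · rintro ⟨w, ⟨h₁, h₂⟩, rfl⟩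
    refine ⟨add_mem hy h₁, ?_⟩
    rw [mul_add, h₂]
    ring

theorem preimagesIn_eq_empty {j : ℕ} {x : ZMod ν} (hx : x ∉ powMultiples ν n (j + 1)) :
    preimagesIn n x j = ∅ := by
  rw [Set.eq_empty_iff_forall_notMem]
  rintro z ⟨h₁, rfl⟩
  exact hx (mul_mem_powMultiples_succ h₁)

/-- The largest `j` such that `x` is a multiple of `n ^ j`. -/
noncomputable def powLevel (n : ℕ) (x : ZMod ν) : ℕ := sInf {j | x ∉ powMultiples ν n (j + 1)}

/-- The subgroups decrease to 0, so a nonzero x leaves the chain at one place. For x = 0 the infimum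
is over the empty set and the level is the default 0. -/
theorem powLevel_eq_iff {e j : ℕ} (he : ν ∣ n ^ e) {x : ZMod ν} (hx : x ≠ 0) :
    powLevel n x = j ↔ x ∈ powMultiples ν n j ∧ x ∉ powMultiples ν n (j + 1) := by
  have hne : {j | x ∉ powMultiples ν n (j + 1)}.Nonempty :=
    ⟨e, fun h => hx (eq_zero_of_mem_powMultiples he (powMultiples_antitone e.le_succ h))⟩
  have key : ∀ i, x ∈ powMultiples ν n i ↔ i ≤ powLevel n x := by
    intro i
    constructor
    · intro hi
      by_contra! hlt
      exact Nat.sInf_mem hne (powMultiples_antitone hlt hi)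
    · intro hi
      cases i with
      | zero => exact mem_powMultiples_zero x
      | succ i =>
        by_contra h
        exact absurd (Nat.sInf_le (s := {j | x ∉ powMultiples ν n (j + 1)}) h) (not_le.2 hi)
  rw [key, key]
  omega

end powMultiples

/-! ### The tree of multiplication by n on ℤ/ν -/

theorem exists_equiv_levels {κ : Type*} [Finite κ] (lev : κ → ℕ) (k m : ℕ) (v : ℕ → ℕ)
    (hle : ∀ c, lev c ≤ k) (htop : Nat.card {c // lev c = k} = m)
    (hlt : ∀ j < k, Nat.card {c // lev c = j} = v j - v (j + 1)) :
    ∃ e : Fin m ⊕ (Σ i : Fin k, Fin (v i - v (i + 1))) ≃ κ,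
      (∀ a, lev (e (Sum.inl a)) = k) ∧ ∀ p, lev (e (Sum.inr p)) = p.1 := by
  let t := (Finite.equivFinOfCardEq htop).symm
  let l := fun i : Fin k => (Finite.equivFinOfCardEq (hlt i i.2)).symm
  let φ : Fin m ⊕ (Σ i : Fin k, Fin (v i - v (i + 1))) → κ :=
    Sum.elim (fun a => (t a).1) (fun p => (l p.1 p.2).1)
  have h₁ : ∀ a, lev (φ (Sum.inl a)) = k := fun a => (t a).2
  have h₂ : ∀ p, lev (φ (Sum.inr p)) = p.1 := fun p => (l p.1 p.2).2
  have hφ : Function.Bijective φ := by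
    constructor
    · rintro (a | ⟨i, a⟩) (b | ⟨j, b⟩) h
      · exact congrArg Sum.inl (t.injective (Subtype.ext h))
      · have := congrArg lev h
        rw [h₁, h₂] at this
        exact absurd this.symm j.2.ne
      · have := congrArg lev h
        rw [h₁, h₂] at this
        exact absurd this i.2.ne
      · have := congrArg lev h
        rw [h₂, h₂] at this
        obtain rfl : i = j := Fin.ext this
        obtain rfl : a = b := (l i).injective (Subtype.ext h)
        rfl
    · intro c
      rcases (hle c).eq_or_lt with h | h
      · exact ⟨Sum.inl (t.symm ⟨c, h⟩), by simp [φ]⟩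
      · exact ⟨Sum.inr ⟨⟨lev c, h⟩, (l ⟨lev c, h⟩).symm ⟨c, rfl⟩⟩, by simp [φ]⟩
  exact ⟨Equiv.ofBijective φ hφ, h₁, h₂⟩

/-- Multiplication by `n` on `ℤ/ν`, where `ν` divides a power of `n`, as a tree with root `0`. -/
def mulTree (ν n : ℕ) (h : ∃ e, ν ∣ n ^ e) : ParentTree where
  V := ZMod ν
  root := 0
  parent x := n * x
  parent_root := mul_zero _
  reaches_root x := by
    obtain ⟨e, he⟩ := h
    refine ⟨e, ?_⟩
    rw [mul_left_iterate, ← Nat.cast_pow, (ZMod.natCast_eq_zero_iff _ _).2 he]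
    exact zero_mul x

section mulTree

variable {ν n : ℕ} [NeZero ν] (h : ∃ e, ν ∣ n ^ e)

instance (x : ZMod ν) : Finite ((mulTree ν n h).Child x) :=
  inferInstanceAs (Finite {z : ZMod ν // z ≠ 0 ∧ (n : ZMod ν) * z = x})

/-- Level exactly j means lying in n^j ℤ/ν but not in n^(j+1) ℤ/ν. The difference of the two fibres
omits 0 automatically, as 0 is in every subgroup. -/
theorem natCard_child_powLevel (x : ZMod ν) (j : ℕ) :
    Nat.card {c : (mulTree ν n h).Child x // powLevel (ν := ν) n c.1 = j} =
      (preimagesIn n x j).ncard - (preimagesIn n x (j + 1)).ncard := by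
  obtain ⟨e, he⟩ := h
  have hsub : preimagesIn n x (j + 1) ⊆ preimagesIn n x j :=
    fun z hz => ⟨powMultiples_antitone j.le_succ hz.1, hz.2⟩
  rw [← Set.ncard_sdiff hsub, ← Nat.card_coe_set_eq]
  refine Nat.card_congr ⟨fun c => ⟨c.1.1, ?_⟩, fun z => ⟨⟨z.1, ?_, z.2.1.2⟩, ?_⟩,
    fun _ => rfl, fun _ => rfl⟩
  · have hc := (powLevel_eq_iff he c.1.2.1).1 c.2
    exact ⟨⟨hc.1, c.1.2.2⟩, fun h => hc.2 h.1⟩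
  · intro h0
    exact z.2.2 ⟨h0 ▸ zero_mem _, z.2.1.2⟩
  · have h0 : z.1 ≠ 0 := fun h0 => z.2.2 ⟨h0 ▸ zero_mem _, z.2.1.2⟩
    exact (powLevel_eq_iff he h0).2 ⟨z.2.1.1, fun h => z.2.2 ⟨h, z.2.1.2⟩⟩

omit [NeZero ν] in
theorem child_mem_powMultiples {x : ZMod ν} (c : (mulTree ν n h).Child x) {j : ℕ}
    (hc : powLevel (ν := ν) n c.1 = j) :
    (c.1 : ZMod ν) ∈ powMultiples ν n j ∧ (c.1 : ZMod ν) ∉ powMultiples ν n (j + 1) :=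
  (powLevel_eq_iff h.choose_spec c.2.1).1 hc

/-- The step shared by the inner vertices and the root 0, which differ only in the number `m` of
children of top level. -/
theorem subtree_isomorphic_graft_of_ncard {x : ZMod ν} {k m : ℕ} (v : ℕ → ℕ)
    (hsub : ∀ j ≤ k, ∀ z : ZMod ν, z ∈ powMultiples ν n j → z ∉ powMultiples ν n (j + 1) →
      ((mulTree ν n h).subtree z).Isomorphic (partialTree v j))
    (hle : ∀ c : (mulTree ν n h).Child x, powLevel (ν := ν) n c.1 ≤ k)
    (htop : (preimagesIn n x k).ncard - (preimagesIn n x (k + 1)).ncard = m)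
    (hlt : ∀ j ≤ k, (preimagesIn n x j).ncard = v j) :
    ((mulTree ν n h).subtree x).Isomorphic
      (ParentTree.graft (ι := Fin m ⊕ (Σ i : Fin k, Fin (v i - v (i + 1))))
        (Sum.elim (fun _ => partialTree v k) (fun p => partialTree v p.1))) := by
  obtain ⟨e, h₁, h₂⟩ := exists_equiv_levels
    (fun c : (mulTree ν n h).Child x => powLevel (ν := ν) n c.1) k m v hle
    (by rw [natCard_child_powLevel, htop])
    (fun j hj => by rw [natCard_child_powLevel, hlt j hj.le, hlt (j + 1) hj])
  refine ((mulTree ν n h).subtree_isomorphic_graft x).trans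
    (ParentTree.graft_congr e fun p => ?_).symm
  apply ParentTree.Isomorphic.symm
  rcases p with a | p
  · exact hsub k le_rfl _ (child_mem_powMultiples h _ (h₁ a)).1
      (child_mem_powMultiples h _ (h₁ a)).2
  · exact hsub p.1 p.1.2.le _ (child_mem_powMultiples h _ (h₂ p)).1
      (child_mem_powMultiples h _ (h₂ p)).2

/-- Multiplication by n raises the level, so all children of x have level below k and strong
induction applies. -/
theorem subtree_isomorphic_partialTree (k : ℕ) (x : ZMod ν) (hx : x ∈ powMultiples ν n k)
    (hx' : x ∉ powMultiples ν n (k + 1)) :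
    ((mulTree ν n h).subtree x).Isomorphic (partialTree (nuTerm ν n) k) := by
  induction k using Nat.strong_induction_on generalizing x with
  | _ k ih =>
  have hle : ∀ c : (mulTree ν n h).Child x, powLevel (ν := ν) n c.1 + 1 ≤ k := by
    intro c
    by_contra! hlt
    have hc : (mulTree ν n h).parent c.1 ∈ powMultiples ν n _ :=
      mul_mem_powMultiples_succ (child_mem_powMultiples h c rfl).1
    rw [c.2.2] at hc
    exact hx' (powMultiples_antitone hlt hc)
  cases k with
  | zero =>
    have : IsEmpty ((mulTree ν n h).Child x) := ⟨fun c => absurd (hle c) (by omega)⟩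
    rw [partialTree]
    exact ((mulTree ν n h).subtree_isomorphic_graft x).trans (ParentTree.graft_of_isEmpty _)
  | succ k =>
    rw [partialTree]
    refine subtree_isomorphic_graft_of_ncard h (nuTerm ν n)
      (fun j hj z hz hz' => ih j (Nat.lt_succ_of_le hj) z hz hz')
      (fun c => Nat.le_of_succ_le_succ (hle c)) ?_
      (fun j hj => ncard_preimagesIn (powMultiples_antitone (Nat.succ_le_succ hj) hx))
    rw [preimagesIn_eq_empty hx', ncard_preimagesIn hx, Set.ncard_empty, Nat.sub_zero]

theorem mulTree_isomorphic_nuTree : (mulTree ν n h).Isomorphic (nuTree ν n) := by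
  have hν : 0 < ν := NeZero.pos ν
  have hmem : nuLength ν n ∈ {d : ℕ | 0 < d ∧ nuProd ν n d = ν} := by
    apply Nat.sInf_mem
    obtain ⟨e, he⟩ := h
    exact ⟨e + 1, e.succ_pos, by
      rw [nuProd_eq_gcd, Nat.gcd_eq_left (he.trans (pow_dvd_pow n e.le_succ))]⟩
  obtain ⟨hpos, hprod⟩ := hmem
  obtain ⟨k, hk⟩ : ∃ k, nuLength ν n = k + 1 := ⟨_, (Nat.succ_pred_eq_of_pos hpos).symm⟩
  rw [hk, nuProd_eq_gcd, Nat.gcd_eq_left_iff_dvd] at hprod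
  rw [nuTree, hk, elementaryTree]
  refine (mulTree ν n h).subtree_root.trans (subtree_isomorphic_graft_of_ncard (x := 0) h _
    (fun j _ z hz hz' => subtree_isomorphic_partialTree h j z hz hz') (fun c => ?_) ?_
    (fun j _ => ncard_preimagesIn_zero j))
  · by_contra! hlt
    exact c.2.1 (eq_zero_of_mem_powMultiples hprod
      (powMultiples_antitone hlt (child_mem_powMultiples h c rfl).1))
  -- The one solution removed from the top level is 0, which is not its own child; this is the -1 in
  -- `elementaryTree`.
  · have : preimagesIn n (0 : ZMod ν) (k + 1) = {0} := by
      ext z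
      refine ⟨fun hz => eq_zero_of_mem_powMultiples hprod hz.1, ?_⟩
      rintro rfl
      exact ⟨zero_mem _, mul_zero _⟩
    rw [this, Set.ncard_singleton, ncard_preimagesIn_zero]

end mulTree

/-! ### The cycles of multiplication by n on ℤ/ω -/

open Function in
/-- A self-map of a finite set all of whose points have minimal period `m` consists of cycles of
length `m`. -/
theorem exists_equiv_of_minimalPeriod {X : Type*} [Finite X] (f : X → X) {m : ℕ} [NeZero m]
    (hf : ∀ x, minimalPeriod f x = m) :
    ∃ e : X ≃ Fin (Nat.card X / m) × ZMod m, ∀ x, e (f x) = ((e x).1, (e x).2 + 1) := by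
  have hmod : ∀ k x, f^[k % m] x = f^[k] x := fun k x => by
    rw [← hf x, iterate_mod_minimalPeriod_eq]
  let s : Setoid X :=
    { r := fun x y => ∃ k, f^[k] x = y
      iseqv := by
        refine ⟨fun x => ⟨0, rfl⟩, ?_, ?_⟩
        · rintro x _ ⟨k, rfl⟩
          -- Going on to a multiple of m that is at least k leads back to the starting point.
          refine ⟨m * (k + 1) - k, ?_⟩
          have hm : 1 ≤ m := NeZero.pos m
          have hle : k ≤ m * (k + 1) := by nlinarith
          rw [← iterate_add_apply, Nat.sub_add_cancel hle, ← hmod, Nat.mul_mod_right]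
          rfl
        · rintro x _ _ ⟨k, rfl⟩ ⟨l, rfl⟩
          exact ⟨l + k, iterate_add_apply f l k x⟩ }
  let φ : Quotient s × ZMod m → X := fun p => f^[p.2.val] p.1.out
  have hclass : ∀ p, (Quotient.mk s (φ p)) = p.1 := by
    intro p
    conv_rhs => rw [← Quotient.out_eq p.1]
    exact (Quotient.sound ⟨_, rfl⟩ : Quotient.mk s p.1.out = Quotient.mk s (φ p)).symm
  have hφ : Bijective φ := by
    constructor
    · rintro ⟨c, k⟩ ⟨c', k'⟩ h
      obtain rfl : c = c' := by
        have hc := hclass (c, k)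
        rw [h, hclass] at hc
        exact hc.symm
      have hk : k.val = k'.val := iterate_injOn_Iio_minimalPeriod (f := f) (x := c.out)
        (by rw [hf]; exact k.val_lt) (by rw [hf]; exact k'.val_lt) h
      rw [ZMod.val_injective m hk]
    · intro x
      obtain ⟨k, hk⟩ : s (Quotient.mk s x).out x := Quotient.mk_out x
      refine ⟨(Quotient.mk s x, (k : ZMod m)), ?_⟩
      simp only [φ, ZMod.val_natCast, hmod, hk]
  have hcomm : ∀ p, φ (p.1, p.2 + 1) = f (φ p) := by
    intro p
    have : (p.2 + 1 : ZMod m) = ((p.2.val + 1 : ℕ) : ZMod m) := by simp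
    simp only [φ]
    rw [this, ZMod.val_natCast, hmod, iterate_succ_apply']
  have hfin : Finite (Quotient s) := inferInstance
  have hcard : Nat.card (Quotient s) = Nat.card X / m := by
    rw [← Nat.card_congr (Equiv.ofBijective φ hφ), Nat.card_prod, Nat.card_zmod,
      Nat.mul_div_cancel _ (NeZero.pos m)]
  refine ⟨(Equiv.ofBijective φ hφ).symm.trans
    ((Finite.equivFinOfCardEq hcard).prodCongr (Equiv.refl _)), fun x => ?_⟩
  obtain ⟨p, rfl⟩ := hφ.2 x
  have h₁ : (Equiv.ofBijective φ hφ).symm (φ p) = p := (Equiv.ofBijective φ hφ).symm_apply_apply p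
  have h₂ : (Equiv.ofBijective φ hφ).symm (f (φ p)) = (p.1, p.2 + 1) := by
    rw [← hcomm]
    exact (Equiv.ofBijective φ hφ).symm_apply_apply _
  simp [h₁, h₂]

theorem orderOf_natCast_zmod_pos {n d : ℕ} [NeZero d] (h : n.Coprime d) :
    0 < orderOf (n : ZMod d) := by
  rw [← ZMod.coe_unitOfCoprime n h, orderOf_units]
  exact orderOf_pos _

theorem natCard_addOrderOf_eq {ω d : ℕ} [NeZero ω] (hd : d ∣ ω) :
    Nat.card {w : ZMod ω // addOrderOf w = d} = d.totient := by
  classical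
  rw [Nat.card_eq_fintype_card, Fintype.card_subtype]
  exact IsAddCyclic.card_addOrderOf_eq_totient (by rwa [ZMod.card])

theorem addOrderOf_natCast_mul {ω n : ℕ} [NeZero ω] (h : n.Coprime ω) (w : ZMod ω) :
    addOrderOf ((n : ZMod ω) * w) = addOrderOf w := by
  rw [← nsmul_eq_mul]
  apply Nat.Coprime.addOrderOf_nsmul
  apply Nat.Coprime.coprime_dvd_left _ h.symm
  simpa using addOrderOf_dvd_card (x := w)

open Function in
-- Both n^k w = w and n^k = 1 modulo the order of w say that this order divides n^k - 1, taken in ℤ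
-- to avoid truncated subtraction.
theorem minimalPeriod_natCast_mul {ω n : ℕ} (w : ZMod ω) :
    minimalPeriod (fun x => (n : ZMod ω) * x) w = orderOf (n : ZMod (addOrderOf w)) := by
  apply Nat.dvd_right_iff_eq.1
  intro k
  rw [← isPeriodicPt_iff_minimalPeriod_dvd, orderOf_dvd_iff_pow_eq_one, IsPeriodicPt, IsFixedPt,
    mul_left_iterate]
  have h₁ : (n : ZMod ω) ^ k * w = w ↔ ((n : ℤ) ^ k - 1) • w = 0 := by
    rw [zsmul_eq_mul]
    push_cast
    rw [sub_mul, one_mul, sub_eq_zero]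
  have h₂ : (n : ZMod (addOrderOf w)) ^ k = 1 ↔
      (((n : ℤ) ^ k - 1 : ℤ) : ZMod (addOrderOf w)) = 0 := by
    push_cast
    rw [sub_eq_zero]
  rw [h₁, h₂, ZMod.intCast_zmod_eq_zero_iff_dvd, addOrderOf_dvd_iff_zsmul_eq_zero]

/-- Multiplication by `n` on `ℤ/ω`, for `n` prime to `ω`, as a union of cycles. -/
theorem exists_equiv_cycles {ω n : ℕ} [NeZero ω] (h : n.Coprime ω) :
    ∃ e : ZMod ω ≃ Σ d : {d : ℕ // d ∣ ω},
        Fin (d.1.totient / orderOf (n : ZMod d.1)) × ZMod (orderOf (n : ZMod d.1)),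
      ∀ w, e (n * w) = ⟨(e w).1, (e w).2.1, (e w).2.2 + 1⟩ := by
  have key : ∀ d : {d : ℕ // d ∣ ω}, ∃ e : {w : ZMod ω // addOrderOf w = d.1} ≃
      Fin (d.1.totient / orderOf (n : ZMod d.1)) × ZMod (orderOf (n : ZMod d.1)),
      ∀ w, e ⟨n * w.1, (addOrderOf_natCast_mul h w.1).trans w.2⟩ =
        ((e w).1, (e w).2 + 1) := by
    rintro ⟨d, hd⟩
    have : NeZero d := ⟨ne_zero_of_dvd_ne_zero (NeZero.ne ω) hd⟩
    have : NeZero (orderOf (n : ZMod d)) :=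
      ⟨(orderOf_natCast_zmod_pos (h.coprime_dvd_right hd)).ne'⟩
    let f : {w : ZMod ω // addOrderOf w = d} → {w : ZMod ω // addOrderOf w = d} :=
      fun w => ⟨n * w.1, (addOrderOf_natCast_mul h w.1).trans w.2⟩
    have hf : ∀ w, Function.minimalPeriod f w = orderOf (n : ZMod d) := by
      rintro ⟨w, rfl⟩
      rw [← minimalPeriod_natCast_mul w]
      apply Nat.dvd_right_iff_eq.1
      intro k
      rw [← Function.isPeriodicPt_iff_minimalPeriod_dvd,
        ← Function.isPeriodicPt_iff_minimalPeriod_dvd]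
      have hs : Function.Semiconj Subtype.val f (fun x => (n : ZMod ω) * x) := fun _ => rfl
      exact ⟨fun hk => hk.map hs,
        fun hk => Subtype.ext ((hs.iterate_right k ⟨w, rfl⟩).trans hk)⟩
    have := exists_equiv_of_minimalPeriod f hf
    rwa [natCard_addOrderOf_eq hd] at this
  choose e he using key
  let g : ZMod ω → {d : ℕ // d ∣ ω} :=
    fun w => ⟨addOrderOf w, by simpa using addOrderOf_dvd_card (x := w)⟩
  let φ : ZMod ω ≃ Σ d : {d : ℕ // d ∣ ω}, {w : ZMod ω // addOrderOf w = d.1} :=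
    { toFun := fun w => ⟨g w, w, rfl⟩
      invFun := fun p => p.2.1
      left_inv := fun _ => rfl
      right_inv := by
        rintro ⟨⟨d, hd⟩, w, hw⟩
        change addOrderOf w = d at hw
        subst hw
        rfl }
  have hφ : ∀ w, φ (n * w) =
      ⟨(φ w).1, n * w, (addOrderOf_natCast_mul h w).trans (φ w).2.2⟩ := by
    -- The inverse of `φ` forgets the index d, so comparing after it avoids an equality of dependent
    -- pairs.
    intro w
    apply φ.symm.injective
    rw [φ.symm_apply_apply]
    rfl
  refine ⟨φ.trans (Equiv.sigmaCongrRight e), fun w => ?_⟩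
  simp only [Equiv.trans_apply, hφ]
  exact Sigma.ext rfl (heq_of_eq (he _ (φ w).2))

/-! ### Algebraic identities for Rédei functions -/

theorem Finset.sum_range_succ_eq_even_add_odd {M : Type*} [AddCommMonoid M] (f : ℕ → M) (n : ℕ) :
    ∑ m ∈ Finset.range (n + 1), f m = ∑ i ∈ Finset.range (n / 2 + 1), f (2 * i) +
      ∑ i ∈ Finset.range ((n + 1) / 2), f (2 * i + 1) := by
  induction n with
  | zero => simp
  | succ n ih =>
    rw [Finset.sum_range_succ, ih]
    rcases Nat.even_or_odd' n with ⟨k, rfl | rfl⟩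
    · have h₁ : (2 * k + 1) / 2 = k := by omega
      have h₂ : 2 * k / 2 = k := by omega
      have h₃ : (2 * k + 1 + 1) / 2 = k + 1 := by omega
      rw [h₁, h₂, h₃, Finset.sum_range_succ _ k, Finset.sum_range_succ (fun i => f (2 * i + 1)),
        add_assoc]
    · have h₁ : (2 * k + 1) / 2 = k := by omega
      have h₃ : (2 * k + 1 + 1) / 2 = k + 1 := by omega
      have h₂ : (2 * k + 1 + 1 + 1) / 2 = k + 1 := by omega
      rw [h₁, h₂, h₃, Finset.sum_range_succ _ (k + 1), add_right_comm]
      rfl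

theorem redei_binomial {R : Type*} [Field R] (n : ℕ) (x s : R) :
    (x + s) ^ n = redeiNum n x (s ^ 2) + redeiDen n x (s ^ 2) * s := by
  rw [add_comm x s, add_pow, Finset.sum_range_succ_eq_even_add_odd, redeiNum, redeiDen,
    Finset.sum_mul]
  congr 1
  · exact Finset.sum_congr rfl fun i _ => by ring
  · exact Finset.sum_congr rfl fun i _ => by ring

theorem redei_binomial_sub {R : Type*} [Field R] (n : ℕ) (x s : R) :
    (x - s) ^ n = redeiNum n x (s ^ 2) - redeiDen n x (s ^ 2) * s := by
  rw [sub_eq_add_neg, redei_binomial, neg_sq]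
  ring

theorem map_redeiNum {R S : Type*} [Field R] [Field S] (g : R →+* S) (n : ℕ) (x y : R) :
    g (redeiNum n x y) = redeiNum n (g x) (g y) := by
  simp [redeiNum]

theorem map_redeiDen {R S : Type*} [Field R] [Field S] (g : R →+* S) (n : ℕ) (x y : R) :
    g (redeiDen n x y) = redeiDen n (g x) (g y) := by
  simp [redeiDen]

theorem coe_mem_redeiDomain {F : Type*} [Field F] {a x : F} :
    (x : OnePoint F) ∈ redeiDomain a ↔ x ^ 2 ≠ a := by
  constructor
  · intro h hx
    exact h x hx rfl
  · rintro h s hs hxs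
    rw [OnePoint.coe_eq_coe] at hxs
    exact h (hxs ▸ hs)

theorem infty_mem_redeiDomain {F : Type*} [Field F] (a : F) :
    (OnePoint.infty : OnePoint F) ∈ redeiDomain a :=
  fun s _ => OnePoint.infty_ne_coe s

theorem redei_infty {F : Type*} [Field F] (n : ℕ) (a : F) :
    redei n a OnePoint.infty = OnePoint.infty := rfl

open Classical in
theorem redei_coe {F : Type*} [Field F] (n : ℕ) (a x : F) :
    redei n a (x : OnePoint F) = if redeiDen n x a = 0 then OnePoint.infty
      else ((redeiNum n x a / redeiDen n x a : F) : OnePoint F) := rfl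

/-- The norm identity: multiply the expansions of (x + s)^n and (x - s)^n. The algebraic closure
supplies s when `a` is not a square in `F`. -/
theorem redeiNum_sq_sub {F : Type*} [Field F] (n : ℕ) (a x : F) :
    redeiNum n x a ^ 2 - redeiDen n x a ^ 2 * a = (x ^ 2 - a) ^ n := by
  obtain ⟨s, hs⟩ := IsAlgClosed.exists_pow_nat_eq (algebraMap F (AlgebraicClosure F) a) two_pos
  apply (algebraMap F (AlgebraicClosure F)).injective
  simp only [map_sub, map_mul, map_pow, map_redeiNum, map_redeiDen, ← hs]
  rw [sq_sub_sq, mul_pow, redei_binomial, redei_binomial_sub]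
  ring

theorem redei_mem_redeiDomain {F : Type*} [Field F] (n : ℕ) (a : F) {u : OnePoint F}
    (hu : u ∈ redeiDomain a) : redei n a u ∈ redeiDomain a := by
  induction u using OnePoint.rec with
  | infty => exact infty_mem_redeiDomain a
  | coe x =>
    rw [redei_coe]
    split_ifs with hD
    · exact infty_mem_redeiDomain a
    · rw [coe_mem_redeiDomain] at hu ⊢
      intro h
      rw [div_pow, div_eq_iff (pow_ne_zero 2 hD), mul_comm, ← sub_eq_zero, redeiNum_sq_sub] at h
      exact pow_ne_zero n (sub_ne_zero.2 hu) h

/-! ### The conjugating Möbius map -/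

section cayley

variable {F K : Type*} [Field F] [Field K] [Algebra F K]

/-- The map `x ↦ (x + s) / (x - s)` on the projective line, with `∞ ↦ 1`. -/
def cayley (s : K) : OnePoint F → K
  | none => 1
  | some x => (algebraMap F K x + s) / (algebraMap F K x - s)

theorem cayley_infty (s : K) : cayley s (OnePoint.infty : OnePoint F) = 1 := rfl

theorem cayley_coe (s : K) (x : F) :
    cayley s (x : OnePoint F) = (algebraMap F K x + s) / (algebraMap F K x - s) := rfl

variable {a : F} {s : K} (hs : s ^ 2 = algebraMap F K a)

include hs

theorem add_ne_zero_and_sub_ne_zero {x : F} (hx : x ^ 2 ≠ a) :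
    algebraMap F K x + s ≠ 0 ∧ algebraMap F K x - s ≠ 0 := by
  rw [← mul_ne_zero_iff, ← sq_sub_sq, hs, ← map_pow, ← map_sub]
  exact (map_ne_zero _).2 (sub_ne_zero.2 hx)

/-- With R = N/D, (R + s)/(R - s) = (N + Ds)/(N - Ds) = (x + s)^n/(x - s)^n. If D = 0 the last
quotient is 1, the image of ∞. -/
theorem cayley_redei (n : ℕ) {u : OnePoint F} (hu : u ∈ redeiDomain a) :
    cayley s (redei n a u) = cayley s u ^ n := by
  induction u using OnePoint.rec with
  | infty => rw [redei_infty, cayley_infty, one_pow]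
  | coe x =>
    obtain ⟨h₁, h₂⟩ := add_ne_zero_and_sub_ne_zero hs (coe_mem_redeiDomain.1 hu)
    have e₁ := redei_binomial n (algebraMap F K x) s
    have e₂ := redei_binomial_sub n (algebraMap F K x) s
    rw [hs, ← map_redeiNum, ← map_redeiDen] at e₁ e₂
    rw [cayley_coe, div_pow, redei_coe]
    split_ifs with hD
    · rw [hD, map_zero, zero_mul, add_zero] at e₁
      rw [hD, map_zero, zero_mul, sub_zero] at e₂
      rw [e₁.trans e₂.symm, cayley_infty, div_self (pow_ne_zero n h₂)]
    · have hD' : algebraMap F K (redeiDen n x a) ≠ 0 := (map_ne_zero _).2 hD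
      rw [cayley_coe, map_div₀, div_add' _ _ _ hD', div_sub' hD',
        div_div_div_cancel_right₀ hD', e₁, e₂]
      ring

/-- A Möbius map of determinant -2s. -/
theorem cayley_injOn (h2s : 2 * s ≠ 0) :
    Set.InjOn (cayley s : OnePoint F → K) (redeiDomain a) := by
  intro u hu w hw h
  have hone : ∀ x : F, x ^ 2 ≠ a → cayley s (x : OnePoint F) ≠ 1 := by
    intro x hx h
    rw [cayley_coe, div_eq_one_iff_eq (add_ne_zero_and_sub_ne_zero hs hx).2] at h
    exact h2s (by linear_combination h)
  induction u using OnePoint.rec with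
  | infty =>
    induction w using OnePoint.rec with
    | infty => rfl
    | coe y => exact absurd h.symm (hone y (coe_mem_redeiDomain.1 hw))
  | coe x =>
    induction w using OnePoint.rec with
    | infty => exact absurd h (hone x (coe_mem_redeiDomain.1 hu))
    | coe y =>
      rw [cayley_coe, cayley_coe,
        div_eq_div_iff (add_ne_zero_and_sub_ne_zero hs (coe_mem_redeiDomain.1 hu)).2
          (add_ne_zero_and_sub_ne_zero hs (coe_mem_redeiDomain.1 hw)).2] at h
      have : algebraMap F K x = algebraMap F K y :=
        mul_left_cancel₀ h2s (by linear_combination -h)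
      rw [(algebraMap F K).injective this]

/-- By Euler's criterion Frobenius sends s to χ(a)s, so it fixes t = (x + s)/(x - s) if χ(a) = 1 and
inverts it if χ(a) = -1. -/
theorem cayley_pow_eq_one [Fintype F] [DecidableEq F] (hF : ringChar F ≠ 2) (ha : a ≠ 0) {N : ℕ}
    (hN : (Fintype.card F : ℤ) - quadraticChar F a = N) {u : OnePoint F}
    (hu : u ∈ redeiDomain a) : cayley s u ^ N = 1 := by
  induction u using OnePoint.rec with
  | infty => rw [cayley_infty, one_pow]
  | coe x =>
    obtain ⟨h₁, h₂⟩ := add_ne_zero_and_sub_ne_zero hs (coe_mem_redeiDomain.1 hu)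
    have hσs : FiniteField.frobeniusAlgHom F K s = algebraMap F K (quadraticChar F a : F) * s := by
      rw [FiniteField.coe_frobeniusAlgHom, quadraticChar_eq_pow_of_char_ne_two' hF, map_pow, ← hs,
        ← pow_mul, ← pow_succ]
      have hodd := FiniteField.odd_card_of_char_ne_two hF
      have hq : 2 * (Fintype.card F / 2) + 1 = Fintype.card F := by omega
      rw [hq]
    have hσ : (cayley s (x : OnePoint F)) ^ Fintype.card F =
        FiniteField.frobeniusAlgHom F K (cayley s (x : OnePoint F)) := by
      rw [FiniteField.coe_frobeniusAlgHom]
    rw [cayley_coe, map_div₀, map_add, map_sub, AlgHom.commutes, hσs] at hσ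
    rw [cayley_coe]
    have ht := div_ne_zero h₁ h₂
    rcases quadraticChar_dichotomy ha with h | h
    · have hq : N + 1 = Fintype.card F := by rw [h] at hN; omega
      rw [h, Int.cast_one, map_one, one_mul, ← hq, pow_succ] at hσ
      exact mul_right_cancel₀ ht (hσ.trans (one_mul _).symm)
    · have hq : N = Fintype.card F + 1 := by rw [h] at hN; omega
      rw [hq, pow_succ, hσ, h]
      simp only [Int.cast_neg, Int.cast_one, map_neg, map_one, neg_mul, one_mul, sub_neg_eq_add,
        ← sub_eq_add_neg]
      rw [div_mul_div_comm, mul_comm, div_self (mul_ne_zero h₁ h₂)]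

end cayley

/-! ### Conjugacy with multiplication on ℤ/N -/

section

variable {F : Type*} [Field F] [Fintype F] [DecidableEq F]

/-- Of the q + 1 points, 1 + χ(a) square roots of `a` are removed. -/
theorem natCard_redeiDomain (hF : ringChar F ≠ 2) (a : F) {N : ℕ}
    (hN : (Fintype.card F : ℤ) - quadraticChar F a = N) : Nat.card (redeiDomain a) = N := by
  have hfin : Finite (OnePoint F) := inferInstanceAs (Finite (Option F))
  have hcard : Nat.card (OnePoint F) = Fintype.card F + 1 :=
    (Finite.card_option (α := F)).trans (by rw [Nat.card_eq_fintype_card])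
  have hcompl : (redeiDomain a)ᶜ = ((↑) : F → OnePoint F) '' {x | x ^ 2 = a} := by
    ext u
    induction u using OnePoint.rec with
    | infty => simp [infty_mem_redeiDomain]
    | coe x => simp [coe_mem_redeiDomain]
  have h := Set.ncard_add_ncard_compl (redeiDomain a)
  rw [hcompl, Set.ncard_image_of_injective _ OnePoint.coe_injective, hcard,
    Set.ncard_eq_toFinset_card' {x : F | x ^ 2 = a}] at h
  have hs := quadraticChar_card_sqrts hF a
  rw [Nat.card_coe_set_eq]
  omega

/-- The Rédei functions are conjugate to the multiplications by `n` on a cyclic group. -/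
theorem exists_equiv_redeiDomain (hF : ringChar F ≠ 2) {a : F} (ha : a ≠ 0) {N : ℕ} [NeZero N]
    (hN : (Fintype.card F : ℤ) - quadraticChar F a = N) :
    ∃ e : redeiDomain a ≃ ZMod N, ∀ (n : ℕ) (u : redeiDomain a),
      e ⟨redei n a u, redei_mem_redeiDomain n a u.2⟩ = n * e u := by
  obtain ⟨s, hs⟩ := IsAlgClosed.exists_pow_nat_eq (algebraMap F (AlgebraicClosure F) a) two_pos
  have h2s : 2 * s ≠ 0 := by
    apply mul_ne_zero
    · rw [← map_ofNat (algebraMap F (AlgebraicClosure F)) 2]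
      exact (map_ne_zero _).2 (Ring.two_ne_zero hF)
    · rintro rfl
      rw [zero_pow two_ne_zero] at hs
      exact (map_ne_zero (algebraMap F (AlgebraicClosure F))).2 ha hs.symm
  let φ : redeiDomain a → rootsOfUnity N (AlgebraicClosure F) :=
    fun u => rootsOfUnity.mkOfPowEq (cayley s u.1) (cayley_pow_eq_one hs hF ha hN u.2)
  have hφval : ∀ u, ((φ u : (AlgebraicClosure F)ˣ) : AlgebraicClosure F) = cayley s u.1 :=
    fun u => rfl
  have hinj : Function.Injective φ := by
    intro u w h
    apply Subtype.ext
    apply cayley_injOn hs h2s u.2 w.2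
    rw [← hφval, ← hφval, h]
  -- An injection from N points into at most N roots of unity is bijective, so the separability of
  -- X^N - 1 need not be checked.
  have hle : Nat.card (rootsOfUnity N (AlgebraicClosure F)) ≤ N := card_rootsOfUnity _ _
  have hcard := natCard_redeiDomain hF a hN
  have hbij := hinj.bijective_of_nat_card_le (hle.trans hcard.ge)
  have hcard' : Nat.card (rootsOfUnity N (AlgebraicClosure F)) =
      Nat.card (Multiplicative (ZMod N)) := by
    rw [← Nat.card_eq_of_bijective φ hbij, hcard]
    exact (Nat.card_zmod N).symm
  let ψ := mulEquivOfCyclicCardEq hcard'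
  refine ⟨((Equiv.ofBijective φ hbij).trans ψ.toEquiv).trans Multiplicative.toAdd,
    fun n u => ?_⟩
  have hpow : φ ⟨redei n a u, redei_mem_redeiDomain n a u.2⟩ = φ u ^ n := by
    apply Subtype.ext
    apply Units.ext
    rw [hφval, SubgroupClass.coe_pow, Units.val_pow_eq_pow_val, hφval]
    exact cayley_redei hs n u.2
  change (ψ (φ _)).toAdd = n * (ψ (φ u)).toAdd
  rw [hpow, map_pow, toAdd_pow, nsmul_eq_mul]

end

/-! ### Assembling cycles and trees -/

open Classical in
theorem ParentTree.cyc_adj_iff {m : ℕ} {T : ParentTree} {p q : ZMod m × T.V} :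
    (ParentTree.cyc m T).Adj p q ↔
      q = (if p.2 = T.root then p.1 + 1 else p.1, T.parent p.2) := by
  obtain ⟨i, u⟩ := p
  obtain ⟨j, v⟩ := q
  by_cases h : u = T.root
  · simp [cyc, toDigraph, h, T.parent_root, and_comm]
  · simp [cyc, toDigraph, h, eq_comm]

/-- Applied twice, this makes the target the graph of a single map, so that the isomorphism becomes
a conjugacy of maps. -/
theorem disjointUnion_adj_iff {ι : Type*} {V : ι → Type*} (G : ∀ i, Digraph (V i))
    (g : ∀ i, V i → V i) (hG : ∀ i u v, (G i).Adj u v ↔ v = g i u) (p q : Σ i, V i) :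
    (disjointUnion G).Adj p q ↔ q = ⟨p.1, g p.1 p.2⟩ := by
  constructor
  · rintro ⟨i, u, v, rfl, rfl, h⟩
    rw [(hG i u v).1 h]
  · rintro rfl
    exact ⟨p.1, p.2, _, rfl, rfl, (hG _ _ _).2 rfl⟩

open Classical in
/-- The product of a tree, whose root is a fixed point, and a union of cycles is a union of cycles
of trees: the vertex `(u, w)` hangs from the point of the cycle of `w` reached when `u` has reached
the root. -/
theorem exists_equiv_tree_prod_cycles {U V W ι : Type*} {K M : ι → Type*} {f : U → U} {r : U}
    (hr : f r = r) (depth : U → ℕ) (hdepth₀ : depth r = 0)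
    (hdepth : ∀ u, u ≠ r → depth u = depth (f u) + 1) (τ : U ≃ V) {p : V → V}
    (hp : ∀ u, τ (f u) = p (τ u)) (g : Equiv.Perm W) (c : W ≃ Σ d, K d × M d)
    (s : ∀ d, M d → M d) (hc : ∀ w, c (g w) = ⟨(c w).1, (c w).2.1, s _ (c w).2.2⟩) :
    ∃ e : U × W ≃ Σ d, Σ _ : K d, M d × V, ∀ u w, e (f u, g w) =
      ⟨(e (u, w)).1, (e (u, w)).2.1,
        if (e (u, w)).2.2.2 = τ r then s _ (e (u, w)).2.2.1 else (e (u, w)).2.2.1,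
        p (e (u, w)).2.2.2⟩ := by
  let A : (V × Σ d, K d × M d) ≃ Σ d, Σ _ : K d, M d × V :=
    { toFun := fun p => ⟨p.2.1, p.2.2.1, p.2.2.2, p.1⟩
      invFun := fun p => (p.2.2.2, ⟨p.1, p.2.1, p.2.2.1⟩)
      left_inv := fun _ => rfl
      right_inv := fun _ => rfl }
  -- Away from the root, one step lowers the depth of u by one and advances w by one `g`, so
  -- g^(depth u) w stays put; at the root it advances along its cycle.
  refine ⟨(Equiv.prodShear τ fun u => (g ^ depth u).trans c).trans A, fun u w => ?_⟩
  change (⟨(c ((g ^ depth (f u)) (g w))).1, (c ((g ^ depth (f u)) (g w))).2.1,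
      (c ((g ^ depth (f u)) (g w))).2.2, τ (f u)⟩ : Σ d, Σ _ : K d, M d × V) =
    ⟨(c ((g ^ depth u) w)).1, (c ((g ^ depth u) w)).2.1,
      if τ u = τ r then s _ (c ((g ^ depth u) w)).2.2 else (c ((g ^ depth u) w)).2.2, p (τ u)⟩
  by_cases hu : u = r
  · subst hu
    have h₁ : (g ^ depth (f u)) (g w) = g w := by rw [hr, hdepth₀]; rfl
    have h₂ : (g ^ depth u) w = w := by rw [hdepth₀]; rfl
    rw [h₁, h₂, hc, if_pos rfl, ← hp, hr]
  · have hτ : τ u ≠ τ r := fun h => hu (τ.injective h)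
    rw [← Equiv.Perm.mul_apply, ← pow_succ, ← hdepth u hu, hp, if_neg hτ]

open Classical in
/-- Multiplication by `n` on `ℤ/νω`, where `ν` divides a power of `n` and `ω` is prime to `n`, as
a union of cycles of trees. -/
theorem exists_equiv_zmod_mul {ν ω n : ℕ} [NeZero ν] [NeZero ω] (h : ∃ e, ν ∣ n ^ e)
    (hcop : n.Coprime ω) :
    ∃ e : ZMod (ν * ω) ≃ Σ d : {d : ℕ // d ∣ ω}, Σ _ : Fin (d.1.totient / orderOf (n : ZMod d.1)),
        ZMod (orderOf (n : ZMod d.1)) × (nuTree ν n).V,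
      ∀ x, e (n * x) = ⟨(e x).1, (e x).2.1,
        if (e x).2.2.2 = (nuTree ν n).root then (e x).2.2.1 + 1 else (e x).2.2.1,
        (nuTree ν n).parent (e x).2.2.2⟩ := by
  have hνω : ν.Coprime ω := by
    obtain ⟨k, hk⟩ := h
    exact (hcop.pow_left k).coprime_dvd_left hk
  obtain ⟨τ, hroot, hparent⟩ := mulTree_isomorphic_nuTree h
  obtain ⟨c, hc⟩ := exists_equiv_cycles hcop
  obtain ⟨e, he⟩ := exists_equiv_tree_prod_cycles (mulTree ν n h).parent_root
    (mulTree ν n h).depth ParentTree.depth_root (fun _ => ParentTree.depth_eq_of_ne) τ hparent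
    (Units.mulLeft (ZMod.unitOfCoprime n hcop)) c (fun _ i => i + 1) hc
  rw [hroot] at he
  refine ⟨(ZMod.chineseRemainder hνω).toEquiv.trans e, fun x => ?_⟩
  have hmul : ZMod.chineseRemainder hνω (n * x) =
      ((n : ZMod ν) * (ZMod.chineseRemainder hνω x).1,
        (n : ZMod ω) * (ZMod.chineseRemainder hνω x).2) := by
    rw [map_mul, map_natCast]
    rfl
  exact (congrArg e hmul).trans (he _ _)

theorem mainTheorem3 {F : Type*} [Field F] [Fintype F] [DecidableEq F]
    (hF : Odd (Fintype.card F)) (n : ℕ) (hn : 0 < n) (a : F) (ha : a ≠ 0)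
    (ν ω : ℕ) (hν : 0 < ν) (hω : 0 < ω)
    (hνω : (Fintype.card F : ℤ) - quadraticChar F a = (ν : ℤ) * (ω : ℤ))
    (hrad : UniqueFactorizationMonoid.radical ν ∣ UniqueFactorizationMonoid.radical n)
    (hcop : Nat.gcd n ω = 1) :
    IsomorphicDigraphs
      (functionalGraph (redei n a) (redeiDomain a))
      (disjointUnion fun d : {d : ℕ // d ∣ ω} =>
        copies (Nat.totient d / orderOf (n : ZMod d))
          (ParentTree.cyc (orderOf (n : ZMod d)) (nuTree ν n))) := by
  classical
  have : NeZero ν := ⟨hν.ne'⟩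
  have : NeZero ω := ⟨hω.ne'⟩
  have hchar : ringChar F ≠ 2 := by
    rw [Ne, FiniteField.even_card_iff_char_two, ← Nat.even_iff]
    exact Nat.not_even_iff_odd.2 hF
  have hpow : ∃ e, ν ∣ n ^ e :=
    (UniqueFactorizationMonoid.exists_dvd_pow_iff_radical_dvd hν.ne').2
      (hrad.trans UniqueFactorizationMonoid.radical_dvd_self)
  obtain ⟨e₁, he₁⟩ := exists_equiv_redeiDomain hchar ha (N := ν * ω) (by exact_mod_cast hνω)
  obtain ⟨e₂, he₂⟩ := exists_equiv_zmod_mul hpow hcop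
  refine ⟨⟨e₁.trans e₂, fun {u v} => ?_⟩⟩
  refine (disjointUnion_adj_iff _ _ (fun d => disjointUnion_adj_iff _ _ fun _ _ _ =>
    ParentTree.cyc_adj_iff) _ _).trans ?_
  have h := he₂ (e₁ u)
  rw [← he₁] at h
  constructor
  · intro hv
    exact congrArg Subtype.val (e₁.injective (e₂.injective (hv.trans h.symm))).symm
  · intro huv
    have hv : v = ⟨redei n a u, redei_mem_redeiDomain n a u.2⟩ := Subtype.ext (Eq.symm huv)
    exact (congrArg (fun w => e₂ (e₁ w)) hv).trans h
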